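/- Let $\mathcal E_{2,2}$ denote the distribution of the random $2\times 2$ density matrix $\rho=\operatorname{Tr}_2|\psi\rangle\langle\psi|$, where $\psi$ is a Haar-distributed unit vector of $\mathbb C^2\otimes\mathbb C^2$ (i.e. distributed according to the unitarily invariant probability measure on the unit sphere) and $\operatorname{Tr}_2$ is the partial trace over the second tensor factor. Let $\rho_1,\rho_2$ be independent random density matrices, each with distribution $\mathcal E_{2,2}$. Then almost surely the equiprobable mixture can be written in the Bloch representation $$\tfrac12(\rho_1+\rho_2)=\tfrac12\left(\mathbb 1_2+r_x\sigma_x+r_y\sigma_y+r_z\sigma_z\right),$$ where $\sigma_x,\sigma_y,\sigma_z$ are the Pauli matrices and $\boldsymbol r=(r_x,r_y,r_z)\in\mathbb R^3$, with $r_j=\operatorname{Tr}\left(\tfrac12(\rho_1+\rho_2)\sigma_j\right)$, is its Bloch vector, and the Euclidean length $r=|\boldsymbol r|$ of the Bloch vector has, with respect to Lebesgue measure on $\mathbb R$, the probability density function $$p^{(2)}(r)=12r^2(r^3-3r+2)\quad\text{for } r\in[0,1],$$ and $p^{(2)}(r)=0$ for $r\notin[0,1]$. -/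

import Mathlib

open MeasureTheory ProbabilityTheory
open scoped Matrix ComplexOrder

noncomputable section

/-- The entrywise (equivalently, Borel) σ-algebra on complex matrices. -/
instance complexMatrixMeasurableSpace (m n : Type*) : MeasurableSpace (Matrix m n ℂ) :=
  inferInstanceAs (MeasurableSpace (m → n → ℂ))

/-- Pure states of the bipartite system `ℂ^d ⊗ ℂ^k`: unit vectors, with coordinates indexed by
`Fin d × Fin k`. -/
abbrev PureState (d k : ℕ) : Type :=
  Metric.sphere (0 : EuclideanSpace ℂ (Fin d × Fin k)) 1

/-- The Haar distribution of pure states: the normalized surface measure on the unit sphere of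
`ℂ^d ⊗ ℂ^k`, i.e. the unitarily invariant probability measure. -/
def haarPureState (d k : ℕ) : Measure (PureState d k) :=
  ((volume : Measure (EuclideanSpace ℂ (Fin d × Fin k))).toSphere Set.univ)⁻¹ •
    (volume : Measure (EuclideanSpace ℂ (Fin d × Fin k))).toSphere

/-- The projector `|ψ⟩⟨ψ|`. -/
def pureDensity {ι : Type*} (ψ : EuclideanSpace ℂ ι) : Matrix ι ι ℂ :=
  Matrix.of fun i j => ψ i * star (ψ j)

/-- Partial trace over the second tensor factor. -/
def partialTraceRight {m n : Type*} [Fintype n] (A : Matrix (m × n) (m × n) ℂ) : Matrix m m ℂ :=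
  Matrix.of fun i j => ∑ l, A (i, l) (j, l)

/-- The reduced state on `ℂ^d` of a pure state of `ℂ^d ⊗ ℂ^k`. -/
def reducedState (d k : ℕ) (ψ : PureState d k) : Matrix (Fin d) (Fin d) ℂ :=
  partialTraceRight (pureDensity (ψ : EuclideanSpace ℂ (Fin d × Fin k)))

/-- The random state ensemble `E_{d,k}`, as the law of a random `d × d` matrix: partial trace over
the `k`-dimensional subsystem of a Haar-distributed pure state of `ℂ^d ⊗ ℂ^k`. -/
def randomStateEnsemble (d k : ℕ) : Measure (Matrix (Fin d) (Fin d) ℂ) :=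
  (haarPureState d k).map (reducedState d k)

/-- The Pauli matrices `σ_x, σ_y, σ_z`. -/
def pauli : Fin 3 → Matrix (Fin 2) (Fin 2) ℂ :=
  ![!![0, 1; 1, 0], !![0, -Complex.I; Complex.I, 0], !![1, 0; 0, -1]]

/-- The Bloch representation `ρ(r) = (1 + r · σ) / 2`. -/
def blochState (r : EuclideanSpace ℝ (Fin 3)) : Matrix (Fin 2) (Fin 2) ℂ :=
  (1 / 2 : ℂ) • (1 + ∑ j, (r j : ℂ) • pauli j)

/-- The Bloch vector of a qubit state, `r_j = Tr (ρ σ_j)`. It is the unique `r` with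
`ρ = blochState r`, see `blochState_eq_iff`. -/
def blochVector (ρ : Matrix (Fin 2) (Fin 2) ℂ) : EuclideanSpace ℝ (Fin 3) :=
  WithLp.toLp 2 fun j => (ρ * pauli j).trace.re

theorem blochState_eq_iff {ρ : Matrix (Fin 2) (Fin 2) ℂ} (hρ : ρ.IsHermitian)
    (htr : ρ.trace = 1) (r : EuclideanSpace ℝ (Fin 3)) :
    ρ = blochState r ↔ r = blochVector ρ := by
  have h00 := congrArg Complex.im (hρ.apply 0 0)
  have h11 := congrArg Complex.im (hρ.apply 1 1)
  have h01r := congrArg Complex.re (hρ.apply 0 1)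
  have h01i := congrArg Complex.im (hρ.apply 0 1)
  have htr_re := congrArg Complex.re htr
  simp [Matrix.trace_fin_two] at h00 h11 h01r h01i htr_re
  constructor
  · rintro rfl
    ext j
    fin_cases j <;>
      simp [blochVector, blochState, pauli, Fin.sum_univ_three, Matrix.trace_fin_two,
        Matrix.mul_apply] <;> ring
  · rintro rfl
    ext i j
    fin_cases i <;> fin_cases j <;> apply Complex.ext <;>
      simp [blochVector, blochState, pauli, Fin.sum_univ_three, Matrix.trace_fin_two,
        Matrix.mul_apply] <;> linarith

theorem reducedState_posSemidef (d k : ℕ) (ψ : PureState d k) :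
    (reducedState d k ψ).PosSemidef := by
  have h : reducedState d k ψ =
      (Matrix.of fun (i : Fin d) (l : Fin k) => (ψ : EuclideanSpace ℂ (Fin d × Fin k)) (i, l)) *
      (Matrix.of fun (i : Fin d) (l : Fin k) =>
        (ψ : EuclideanSpace ℂ (Fin d × Fin k)) (i, l))ᴴ := by
    ext i j
    simp [reducedState, partialTraceRight, pureDensity, Matrix.mul_apply]
  rw [h]
  exact Matrix.posSemidef_self_mul_conjTranspose _

theorem reducedState_trace (d k : ℕ) (ψ : PureState d k) : (reducedState d k ψ).trace = 1 := by
  have h1 : ‖(ψ : EuclideanSpace ℂ (Fin d × Fin k))‖ ^ 2 = 1 := by simp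
  rw [EuclideanSpace.norm_sq_eq, Fintype.sum_prod_type] at h1
  simp only [Matrix.trace, reducedState, partialTraceRight, pureDensity, Matrix.diag_apply,
    Matrix.of_apply, Complex.star_def, Complex.mul_conj']
  exact_mod_cast h1

theorem measurable_reducedState (d k : ℕ) : Measurable (reducedState d k) := by
  refine measurable_pi_lambda _ fun i => measurable_pi_lambda _ fun j => ?_
  simp only [reducedState, partialTraceRight, pureDensity, Matrix.of_apply]
  fun_prop

instance haarPureState_isProbabilityMeasure (d k : ℕ) [NeZero d] [NeZero k] :
    IsProbabilityMeasure (haarPureState d k) := by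
  constructor
  rw [haarPureState, Measure.smul_apply, smul_eq_mul]
  refine ENNReal.inv_mul_cancel ?_ (measure_ne_top _ _)
  rw [Ne, Measure.measure_univ_eq_zero]
  exact Measure.toSphere_ne_zero _

instance randomStateEnsemble_isProbabilityMeasure (d k : ℕ) [NeZero d] [NeZero k] :
    IsProbabilityMeasure (randomStateEnsemble d k) :=
  Measure.isProbabilityMeasure_map (measurable_reducedState d k).aemeasurable

end

/-! Every law is identified through characteristic functions, which reduces a problem on `ℝ³` to a
Fourier identity in one variable.

For one reduced state, a special unitary on the first tensor factor turns `t · σ` into `‖t‖ σ_z`.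
Haar invariance therefore makes the characteristic function of the Bloch vector at `t` equal to that
of the Pauli expectation `z` at `‖t‖` (`charFun_map_blochVector`). The law of `z` comes from
replacing the Haar vector by a normalized Gaussian: `z` is then `(‖a‖² - ‖b‖²) / (‖a‖² + ‖b‖²)` for
the two rows `a, b ∈ ℂ²`, and scaling out `b` leaves a radial integral over `ℝ⁴` that yields the
density `3/4 (1 - z²)` (`map_zExpectation`).

By independence, the Bloch vector of the mixture has as characteristic function at `t` the square of
this transform at `‖t‖ / 2`. The candidate law on `ℝ³` has density `3/π (r³ - 3r + 2)` on the unit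
ball. Integrating it over planes gives its one-dimensional marginal
(`integral_mixtureProfile_slice`), whose Fourier transform is exactly that square
(`sq_integral_cexp_eq`). Uniqueness of characteristic functions identifies the two laws, and the
sphere area `4πr²` turns the density on `ℝ³` into `12r²(r³ - 3r + 2)`. -/

/-! ### Haar integrals as Gaussian integrals -/

open Measure in
/-- Integration in polar coordinates of a product of an angular and a radial function. -/
theorem lintegral_angular_mul_radial {E : Type*} [NormedAddCommGroup E] [NormedSpace ℝ E]
    [MeasurableSpace E] [BorelSpace E] [FiniteDimensional ℝ E] [Nontrivial E]
    (μ : Measure E) [μ.IsAddHaarMeasure] {F : E → ENNReal} (hF : Measurable F)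
    {g : ℝ → ENNReal} (hg : Measurable g) :
    ∫⁻ x, F (‖x‖⁻¹ • x) * g ‖x‖ ∂μ = (∫⁻ y, F y ∂μ.toSphere) *
      ∫⁻ r in Set.Ioi (0 : ℝ), ENNReal.ofReal (r ^ (Module.finrank ℝ E - 1)) * g r := by
  have hms : MeasurableSet ({0}ᶜ : Set E) := (measurableSet_singleton _).compl
  calc
    _ = ∫⁻ x : ({(0)}ᶜ : Set E), F (‖x.1‖⁻¹ • x.1) * g ‖x.1‖ ∂(μ.comap (↑)) := by
      rw [lintegral_subtype_comap hms fun x ↦ F (‖x‖⁻¹ • x) * g ‖x‖, restrict_compl_singleton]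
    _ = ∫⁻ p, F p.1 * g p.2 ∂μ.toSphere.prod (.volumeIoiPow (Module.finrank ℝ E - 1)) := by
      rw [← μ.measurePreserving_homeomorphUnitSphereProd.lintegral_comp_emb
        (Homeomorph.measurableEmbedding _)]
      simp
    _ = (∫⁻ y, F y ∂μ.toSphere) *
        ∫⁻ r : Set.Ioi (0 : ℝ), g r ∂(.volumeIoiPow (Module.finrank ℝ E - 1)) :=
      lintegral_prod_mul (f := fun y : Metric.sphere (0 : E) 1 => F y)
        (g := fun r : Set.Ioi (0 : ℝ) => g r)
        (hF.comp measurable_subtype_coe).aemeasurable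
        (hg.comp measurable_subtype_coe).aemeasurable
    _ = _ := by
      rw [Measure.volumeIoiPow, lintegral_withDensity_eq_lintegral_mul _ (by fun_prop)
        (g := fun r : Set.Ioi (0 : ℝ) => g r) (hg.comp measurable_subtype_coe),
        ← lintegral_subtype_comap measurableSet_Ioi]
      rfl

theorem lintegral_comp_smul_addHaar {E : Type*} [NormedAddCommGroup E] [NormedSpace ℝ E]
    [MeasurableSpace E] [BorelSpace E] [FiniteDimensional ℝ E]
    (μ : Measure E) [μ.IsAddHaarMeasure] (f : E → ENNReal) {c : ℝ} (hc : 0 < c) :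
    ∫⁻ x, f x ∂μ = ENNReal.ofReal (c ^ Module.finrank ℝ E) * ∫⁻ x, f (c • x) ∂μ := by
  have h := lintegral_map_equiv (μ := μ) f (Homeomorph.smulOfNeZero c hc.ne').toMeasurableEquiv
  have h2 : Measure.map (Homeomorph.smulOfNeZero c hc.ne' : E ≃ₜ E).toMeasurableEquiv μ =
      ENNReal.ofReal |(c ^ Module.finrank ℝ E)⁻¹| • μ :=
    Measure.map_addHaar_smul μ hc.ne'
  rw [h2, lintegral_smul_measure] at h
  have h3 : ∫⁻ x, f (c • x) ∂μ = ENNReal.ofReal |(c ^ Module.finrank ℝ E)⁻¹| • ∫⁻ x, f x ∂μ :=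
    h.symm
  rw [h3, smul_eq_mul, ← mul_assoc, ← ENNReal.ofReal_mul (by positivity),
    abs_of_pos (by positivity : (0 : ℝ) < (c ^ Module.finrank ℝ E)⁻¹),
    mul_inv_cancel₀ (by positivity)]
  simp

/-- Integrals against the Haar distribution as Gaussian integrals of degree-zero homogeneous
functions. -/
theorem exists_lintegral_haarPureState (d k : ℕ) [NeZero d] [NeZero k] :
    ∃ C : ENNReal, ∀ F : EuclideanSpace ℂ (Fin d × Fin k) → ENNReal, Measurable F →
      ∫⁻ ψ, F ψ ∂haarPureState d k =
        C * ∫⁻ x, F (‖x‖⁻¹ • x) * ENNReal.ofReal (Real.exp (-‖x‖ ^ 2)) := by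
  set E := EuclideanSpace ℂ (Fin d × Fin k)
  set σ := (volume : Measure E).toSphere
  set K := ∫⁻ r in Set.Ioi (0 : ℝ), ENNReal.ofReal (r ^ (Module.finrank ℝ E - 1)) *
    ENNReal.ofReal (Real.exp (-r ^ 2))
  have hK0 : K ≠ 0 := by
    refine (setLIntegral_pos_iff (by fun_prop)).2 ?_ |>.ne'
    refine lt_of_lt_of_le ?_ (measure_mono (s := Set.Ioi (0 : ℝ)) ?_)
    · simp
    · intro r hr
      have : 0 < r := hr
      refine ⟨?_, hr⟩
      simp only [Function.mem_support, ne_eq, mul_eq_zero, ENNReal.ofReal_eq_zero, not_or, not_le]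
      exact ⟨by positivity, by positivity⟩
  have hKt : K ≠ ⊤ := by
    have h : IntegrableOn (fun r : ℝ => r ^ (Module.finrank ℝ E - 1) * Real.exp (-r ^ 2))
        (Set.Ioi 0) := by
      have := integrable_rpow_mul_exp_neg_mul_sq (b := 1) one_pos
        (s := (Module.finrank ℝ E - 1 : ℕ)) (by
          have : (0 : ℝ) ≤ (Module.finrank ℝ E - 1 : ℕ) := by positivity
          linarith)
      simpa using this.integrableOn
    have h2 := h.lintegral_lt_top
    refine ne_of_eq_of_ne ?_ h2.ne
    refine setLIntegral_congr_fun measurableSet_Ioi fun r hr => ?_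
    have : 0 < r := hr
    rw [ENNReal.ofReal_mul (by positivity)]
  -- In polar coordinates the Gaussian integral is the angular integral times `K`. Cancelling `K` in
  -- `ENNReal` needs both `K ≠ 0` and `K ≠ ⊤`.
  refine ⟨(σ Set.univ)⁻¹ * K⁻¹, fun F hF => ?_⟩
  rw [lintegral_angular_mul_radial volume hF (g := fun r => ENNReal.ofReal (Real.exp (-r ^ 2)))
    (by fun_prop), haarPureState, lintegral_smul_measure, smul_eq_mul]
  change _ = _ * (_ * K)
  rw [mul_assoc, mul_comm _ K, ← mul_assoc K⁻¹, ENNReal.inv_mul_cancel hK0 hKt, one_mul]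

/-- The Haar distribution of pure states is invariant under linear isometries. -/
theorem lintegral_haarPureState_comp (d k : ℕ) [NeZero d] [NeZero k]
    (V : EuclideanSpace ℂ (Fin d × Fin k) ≃ₗᵢ[ℝ] EuclideanSpace ℂ (Fin d × Fin k))
    {F : EuclideanSpace ℂ (Fin d × Fin k) → ENNReal} (hF : Measurable F) :
    ∫⁻ ψ, F (V ψ) ∂haarPureState d k = ∫⁻ ψ, F ψ ∂haarPureState d k := by
  obtain ⟨C, hC⟩ := exists_lintegral_haarPureState d k
  rw [hC _ hF, hC (fun ψ => F (V ψ)) (hF.comp V.continuous.measurable),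
    ← V.measurePreserving.lintegral_comp (f := fun x => F (‖x‖⁻¹ • x) * _) (by fun_prop)]
  simp

/-! ### The law of one Pauli expectation -/

/-- The ratio is homogeneous of degree zero, so replacing `a` by `‖b‖ a` removes `b` from the
argument of `f`, at the cost of a Jacobian `‖b‖ ^ n`. The remaining integral over `b` is a Gaussian
moment, and scaling evaluates its dependence on `a`. -/
theorem exists_lintegral_gaussian_ratio {V : Type*} [NormedAddCommGroup V] [NormedSpace ℝ V]
    [MeasurableSpace V] [BorelSpace V] [FiniteDimensional ℝ V] [Nontrivial V]
    (μ : Measure V) [μ.IsAddHaarMeasure] :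
    ∃ C : ENNReal, ∀ f : ℝ → ENNReal, Measurable f →
      ∫⁻ p : V × V, f ((‖p.1‖ ^ 2 - ‖p.2‖ ^ 2) / (‖p.1‖ ^ 2 + ‖p.2‖ ^ 2)) *
        ENNReal.ofReal (Real.exp (-(‖p.1‖ ^ 2 + ‖p.2‖ ^ 2))) ∂μ.prod μ =
      C * ∫⁻ a : V, ENNReal.ofReal ((1 + ‖a‖ ^ 2) ^ Module.finrank ℝ V)⁻¹ *
        f ((‖a‖ ^ 2 - 1) / (‖a‖ ^ 2 + 1)) ∂μ := by
  set n := Module.finrank ℝ V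
  refine ⟨∫⁻ b, ENNReal.ofReal (‖b‖ ^ n * Real.exp (-‖b‖ ^ 2)) ∂μ, fun f hf => ?_⟩
  have hne : ∀ᵐ b ∂μ, b ≠ 0 := by
    simp [ae_iff]
  have inner (b : V) (hb : b ≠ 0) :
      ∫⁻ a, f ((‖a‖ ^ 2 - ‖b‖ ^ 2) / (‖a‖ ^ 2 + ‖b‖ ^ 2)) *
        ENNReal.ofReal (Real.exp (-(‖a‖ ^ 2 + ‖b‖ ^ 2))) ∂μ =
      ∫⁻ a, f ((‖a‖ ^ 2 - 1) / (‖a‖ ^ 2 + 1)) *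
        ENNReal.ofReal (‖b‖ ^ n * Real.exp (-(1 + ‖a‖ ^ 2) * ‖b‖ ^ 2)) ∂μ := by
    have hb' : 0 < ‖b‖ := norm_pos_iff.2 hb
    rw [lintegral_comp_smul_addHaar μ _ hb', ← lintegral_const_mul _ (by fun_prop)]
    refine lintegral_congr fun a => ?_
    rw [mul_left_comm, ← ENNReal.ofReal_mul (by positivity)]
    congr 2
    · rw [norm_smul, norm_norm]
      have : ‖a‖ ^ 2 + 1 ≠ 0 := by positivity
      rw [div_eq_div_iff (by positivity) this]
      ring
    · rw [norm_smul, norm_norm]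
      ring_nf
      rfl
  have outer (a : V) :
      ∫⁻ b, ENNReal.ofReal (‖b‖ ^ n * Real.exp (-(1 + ‖a‖ ^ 2) * ‖b‖ ^ 2)) ∂μ =
      (∫⁻ b, ENNReal.ofReal (‖b‖ ^ n * Real.exp (-‖b‖ ^ 2)) ∂μ) *
        ENNReal.ofReal ((1 + ‖a‖ ^ 2) ^ n)⁻¹ := by
    have h1 : 0 < 1 + ‖a‖ ^ 2 := by positivity
    have hs : 0 < √(1 + ‖a‖ ^ 2) := Real.sqrt_pos.2 h1
    have hsq := Real.sq_sqrt h1.le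
    -- Rescaling the reference moment by `√(1 + ‖a‖²)` produces that root to the power `n` twice,
    -- once from the Jacobian and once from `‖b‖ ^ n`; together they give `(1 + ‖a‖²) ^ n`.
    rw [lintegral_comp_smul_addHaar μ (fun b => ENNReal.ofReal (‖b‖ ^ n * Real.exp (-‖b‖ ^ 2))) hs,
      mul_right_comm, ← ENNReal.ofReal_mul (by positivity), ← lintegral_const_mul _ (by fun_prop)]
    refine lintegral_congr fun b => ?_
    rw [← ENNReal.ofReal_mul (by positivity)]
    congr 1
    rw [norm_smul, Real.norm_of_nonneg hs.le]
    have hpow : √(1 + ‖a‖ ^ 2) ^ n * √(1 + ‖a‖ ^ 2) ^ n = (1 + ‖a‖ ^ 2) ^ n := by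
      rw [← mul_pow, Real.mul_self_sqrt h1.le]
    simp only [mul_pow, hsq, neg_mul]
    rw [show Module.finrank ℝ V = n from rfl]
    rw [← mul_assoc, ← mul_assoc, mul_right_comm _ _ (√(1 + ‖a‖ ^ 2) ^ n), hpow,
      mul_inv_cancel₀ (by positivity), one_mul]
  rw [lintegral_prod_symm _ (by fun_prop)]
  dsimp only
  rw [lintegral_congr_ae (hne.mono inner), lintegral_lintegral_swap (by fun_prop),
    ← lintegral_const_mul _ (by fun_prop)]
  refine lintegral_congr fun a => ?_
  rw [lintegral_const_mul _ (by fun_prop), outer]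
  ring

/-- With `z = (r² - 1) / (r² + 1)` one has `1 - z² = 4r² / (r² + 1)²` and `dz = 4r / (r² + 1)² dr`,
whose product is 16 times the weight on the left. -/
theorem setLIntegral_ratio_substitution (f : ℝ → ENNReal) :
    ∫⁻ r in Set.Ioi (0 : ℝ), ENNReal.ofReal (r ^ 3) * (ENNReal.ofReal ((1 + r ^ 2) ^ 4)⁻¹ *
      f ((r ^ 2 - 1) / (r ^ 2 + 1))) =
    ENNReal.ofReal (1 / 16) * ∫⁻ z in Set.Ioo (-1 : ℝ) 1, ENNReal.ofReal (1 - z ^ 2) * f z := by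
  have himg : (fun r : ℝ => (r ^ 2 - 1) / (r ^ 2 + 1)) '' Set.Ioi 0 = Set.Ioo (-1) 1 := by
    ext z
    constructor
    · rintro ⟨r, hr, rfl⟩
      have : 0 < r := hr
      constructor
      · rw [lt_div_iff₀ (by positivity)]; nlinarith [pow_pos this 2]
      · rw [div_lt_iff₀ (by positivity)]; linarith
    · rintro ⟨h1, h2⟩
      have h : 0 < (1 + z) / (1 - z) := div_pos (by linarith) (by linarith)
      refine ⟨√((1 + z) / (1 - z)), Real.sqrt_pos.2 h, ?_⟩
      have : 1 - z ≠ 0 := by linarith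
      dsimp only
      rw [Real.sq_sqrt h.le]
      field_simp
      ring
  have hinj : Set.InjOn (fun r : ℝ => (r ^ 2 - 1) / (r ^ 2 + 1)) (Set.Ioi 0) := by
    intro r hr s hs h
    dsimp only at h
    rw [div_eq_div_iff (by positivity) (by positivity)] at h
    have h2 : r ^ 2 = s ^ 2 := by linarith
    exact (pow_left_inj₀ (le_of_lt hr) (le_of_lt hs) two_ne_zero).1 h2
  rw [← himg, lintegral_image_eq_lintegral_abs_deriv_mul (f' := fun r => 4 * r / (r ^ 2 + 1) ^ 2)
    measurableSet_Ioi _ hinj, ← lintegral_const_mul' _ _ ENNReal.ofReal_ne_top]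
  · refine setLIntegral_congr_fun measurableSet_Ioi fun r hr => ?_
    have hr' : 0 < r := hr
    rw [abs_of_pos (by positivity), ← mul_assoc, ← mul_assoc, ← mul_assoc,
      ← ENNReal.ofReal_mul (by positivity), ← ENNReal.ofReal_mul (by positivity),
      ← ENNReal.ofReal_mul (by positivity)]
    congr 2
    field_simp
    ring
  · intro r _
    have hne : r ^ 2 + 1 ≠ 0 := by positivity
    refine HasDerivAt.hasDerivWithinAt ?_
    refine (((hasDerivAt_pow 2 r).sub_const 1).fun_div
      ((hasDerivAt_pow 2 r).add_const 1) hne).congr_deriv ?_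
    norm_num
    ring

/-- The two rows of a pure state of `ℂ² ⊗ ℂ^k`. -/
noncomputable def rowsIsometry (k : ℕ) : EuclideanSpace ℂ (Fin 2 × Fin k) ≃ₗᵢ[ℝ]
    WithLp 2 (EuclideanSpace ℂ (Fin k) × EuclideanSpace ℂ (Fin k)) where
  toFun ψ := WithLp.toLp 2 (WithLp.toLp 2 fun l => ψ (0, l), WithLp.toLp 2 fun l => ψ (1, l))
  invFun p := WithLp.toLp 2 fun i => ![p.fst i.2, p.snd i.2] i.1
  map_add' _ _ := rfl
  map_smul' _ _ := rfl
  left_inv ψ := by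
    ext ⟨i, l⟩
    fin_cases i <;> rfl
  right_inv _ := rfl
  norm_map' ψ := by
    rw [← sq_eq_sq₀ (norm_nonneg _) (norm_nonneg _), WithLp.prod_norm_sq_eq_of_L2]
    change ‖WithLp.toLp 2 fun l => ψ (0, l)‖ ^ 2 + ‖WithLp.toLp 2 fun l => ψ (1, l)‖ ^ 2 = ‖ψ‖ ^ 2
    simp [EuclideanSpace.norm_sq_eq, Fintype.sum_prod_type]

/-- The expectation of `σ_z` in the first factor of a pure state of `ℂ² ⊗ ℂ²`. -/
noncomputable def zExpectation (ψ : EuclideanSpace ℂ (Fin 2 × Fin 2)) : ℝ :=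
  ‖ψ (0, 0)‖ ^ 2 + ‖ψ (0, 1)‖ ^ 2 - (‖ψ (1, 0)‖ ^ 2 + ‖ψ (1, 1)‖ ^ 2)

@[fun_prop]
theorem continuous_zExpectation : Continuous zExpectation := by
  unfold zExpectation
  fun_prop

theorem exists_lintegral_zExpectation :
    ∃ C : ENNReal, ∀ f : ℝ → ENNReal, Measurable f →
      ∫⁻ ψ, f (zExpectation ψ) ∂haarPureState 2 2 =
        C * ∫⁻ z in Set.Ioo (-1 : ℝ) 1, ENNReal.ofReal (1 - z ^ 2) * f z := by
  obtain ⟨C₁, h₁⟩ := exists_lintegral_haarPureState 2 2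
  obtain ⟨C₂, h₂⟩ := exists_lintegral_gaussian_ratio
    (volume : Measure (EuclideanSpace ℂ (Fin 2)))
  have hdim : Module.finrank ℝ (EuclideanSpace ℂ (Fin 2)) = 4 := by
    rw [← Module.finrank_mul_finrank ℝ ℂ]
    simp
  refine ⟨C₁ * C₂ * (volume : Measure (EuclideanSpace ℂ (Fin 2))).toSphere Set.univ *
    ENNReal.ofReal (1 / 16), fun f hf => ?_⟩
  have key : ∫⁻ x : EuclideanSpace ℂ (Fin 2 × Fin 2), f (zExpectation (‖x‖⁻¹ • x)) *
      ENNReal.ofReal (Real.exp (-‖x‖ ^ 2)) =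
        C₂ * ∫⁻ a : EuclideanSpace ℂ (Fin 2),
          ENNReal.ofReal ((1 + ‖a‖ ^ 2) ^ Module.finrank ℝ (EuclideanSpace ℂ (Fin 2)))⁻¹ *
            f ((‖a‖ ^ 2 - 1) / (‖a‖ ^ 2 + 1)) := by
    rw [← h₂ f hf, ← Measure.volume_eq_prod, ← (WithLp.volume_preserving_ofLp _ _).lintegral_comp
      (by fun_prop), ← (rowsIsometry 2).measurePreserving.lintegral_comp (by fun_prop)]
    refine lintegral_congr fun x => ?_
    have hx : ‖x‖ ^ 2 = ‖(rowsIsometry 2 x).fst‖ ^ 2 + ‖(rowsIsometry 2 x).snd‖ ^ 2 := by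
      rw [← WithLp.prod_norm_sq_eq_of_L2, LinearIsometryEquiv.norm_map]
    rw [hx]
    congr 2
    change _ = (‖(rowsIsometry 2 x).fst‖ ^ 2 - ‖(rowsIsometry 2 x).snd‖ ^ 2) /
      (‖(rowsIsometry 2 x).fst‖ ^ 2 + ‖(rowsIsometry 2 x).snd‖ ^ 2)
    rw [← hx]
    change _ = (‖WithLp.toLp 2 fun l => x (0, l)‖ ^ 2 - ‖WithLp.toLp 2 fun l => x (1, l)‖ ^ 2) / _
    simp [zExpectation, mul_pow, EuclideanSpace.norm_sq_eq]
    ring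
  rw [h₁ (fun x => f (zExpectation x)) (by fun_prop), key]
  have := lintegral_angular_mul_radial (volume : Measure (EuclideanSpace ℂ (Fin 2)))
    (F := fun _ => 1) measurable_const
    (g := fun r => ENNReal.ofReal ((1 + r ^ 2) ^ 4)⁻¹ * f ((r ^ 2 - 1) / (r ^ 2 + 1)))
    (by fun_prop)
  simp only [one_mul, lintegral_one] at this
  rw [hdim, this, hdim, setLIntegral_ratio_substitution]
  ring

theorem setLIntegral_one_sub_sq :
    ∫⁻ z in Set.Ioo (-1 : ℝ) 1, ENNReal.ofReal (1 - z ^ 2) = ENNReal.ofReal (4 / 3) := by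
  rw [setLIntegral_congr Ioo_ae_eq_Ioc, ← ofReal_integral_eq_lintegral_ofReal,
    ← intervalIntegral.integral_of_le (by norm_num)]
  · congr 1
    rw [intervalIntegral.integral_sub (by simp) (by simp)]
    simp
    norm_num
  · exact (Continuous.integrableOn_Icc (by fun_prop)).mono_set Set.Ioc_subset_Icc_self
  · filter_upwards [ae_restrict_mem measurableSet_Ioc] with z hz
    show 0 ≤ 1 - z ^ 2
    nlinarith [hz.1, hz.2]

/-- The law of a Pauli expectation. -/
theorem map_zExpectation :
    (haarPureState 2 2).map (fun ψ : PureState 2 2 => zExpectation ψ) =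
      (volume.restrict (Set.Ioo (-1 : ℝ) 1)).withDensity
        fun z => ENNReal.ofReal (3 / 4 * (1 - z ^ 2)) := by
  obtain ⟨C, hC⟩ := exists_lintegral_zExpectation
  -- All constants left implicit so far are fixed by total mass: `f = 1` gives `1 = C · 4/3`.
  have hC1 : C = ENNReal.ofReal (3 / 4) := by
    have h := hC (fun _ => 1) measurable_const
    simp only [lintegral_one, measure_univ, mul_one, setLIntegral_one_sub_sq] at h
    rw [← mul_one (ENNReal.ofReal (3 / 4)), h, mul_left_comm, ← ENNReal.ofReal_mul (by norm_num)]
    norm_num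
  refine Measure.ext fun s hs => ?_
  rw [← lintegral_indicator_one hs, lintegral_map (measurable_one.indicator hs) (by fun_prop),
    hC _ (measurable_one.indicator hs), ← lintegral_indicator_one hs,
    lintegral_withDensity_eq_lintegral_mul _ (by fun_prop) (measurable_one.indicator hs), hC1,
    ← lintegral_const_mul' _ _ ENNReal.ofReal_ne_top]
  refine lintegral_congr fun z => ?_
  rw [Pi.mul_apply, ENNReal.ofReal_mul (by norm_num), mul_assoc]

/-! ### Unitary invariance and the Bloch vector of one state -/

/-- The special unitary `!![α, β; -star β, star α]` acting on the first factor of `ℂ² ⊗ ℂ^k`. -/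
noncomputable def firstFactorRotation (k : ℕ) (α β : ℂ) (h : ‖α‖ ^ 2 + ‖β‖ ^ 2 = 1) :
    EuclideanSpace ℂ (Fin 2 × Fin k) ≃ₗᵢ[ℝ] EuclideanSpace ℂ (Fin 2 × Fin k) where
  toFun ψ := WithLp.toLp 2 fun i =>
    ![α * ψ (0, i.2) + β * ψ (1, i.2), -star β * ψ (0, i.2) + star α * ψ (1, i.2)] i.1
  invFun ψ := WithLp.toLp 2 fun i =>
    ![star α * ψ (0, i.2) - β * ψ (1, i.2), star β * ψ (0, i.2) + α * ψ (1, i.2)] i.1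
  map_add' ψ φ := by
    ext ⟨i, l⟩
    fin_cases i <;> simp <;> ring
  map_smul' c ψ := by
    ext ⟨i, l⟩
    fin_cases i <;> simp <;> ring
  left_inv ψ := by
    have h' : α * star α + β * star β = 1 := by
      simp only [Complex.star_def, Complex.mul_conj']
      exact_mod_cast h
    ext ⟨i, l⟩
    fin_cases i
    · simp only [Complex.star_def] at *
      simp
      linear_combination ψ (0, l) * h'
    · simp only [Complex.star_def] at *
      simp
      linear_combination ψ (1, l) * h'
  right_inv ψ := by
    have h' : α * star α + β * star β = 1 := by
      simp only [Complex.star_def, Complex.mul_conj']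
      exact_mod_cast h
    ext ⟨i, l⟩
    fin_cases i
    · simp only [Complex.star_def] at *
      simp
      linear_combination ψ (0, l) * h'
    · simp only [Complex.star_def] at *
      simp
      linear_combination ψ (1, l) * h'
  norm_map' ψ := by
    rw [← sq_eq_sq₀ (norm_nonneg _) (norm_nonneg _)]
    change ‖WithLp.toLp 2 fun i : Fin 2 × Fin k =>
      ![α * ψ (0, i.2) + β * ψ (1, i.2), -star β * ψ (0, i.2) + star α * ψ (1, i.2)] i.1‖ ^ 2 = _
    simp only [EuclideanSpace.norm_sq_eq, Fintype.sum_prod_type, Fin.sum_univ_two,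
      ← Finset.sum_add_distrib]
    refine Finset.sum_congr rfl fun l _ => ?_
    simp only [Complex.sq_norm, Complex.normSq_apply] at *
    simp
    linear_combination ((ψ (0, l)).re ^ 2 + (ψ (0, l)).im ^ 2 + (ψ (1, l)).re ^ 2 +
      (ψ (1, l)).im ^ 2) * h

theorem measurable_blochVector : Measurable blochVector := by
  have h (i j : Fin 2) : Measurable fun ρ : Matrix (Fin 2) (Fin 2) ℂ => ρ i j :=
    (measurable_pi_apply j).comp (measurable_pi_apply i)
  refine (WithLp.measurable_toLp 2 _).comp (measurable_pi_lambda _ fun j => ?_)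
  simp only [Matrix.trace_fin_two, Matrix.mul_apply, Fin.sum_univ_two]
  exact Complex.measurable_re.comp (by fun_prop)

theorem inner_blochVector_reducedState (ψ : PureState 2 2) (t : EuclideanSpace ℝ (Fin 3)) :
    inner ℝ (blochVector (reducedState 2 2 ψ)) t = t 2 * zExpectation ψ +
      2 * (((t 0 : ℂ) + t 1 * Complex.I) *
        (ψ.1 (0, 0) * star (ψ.1 (1, 0)) + ψ.1 (0, 1) * star (ψ.1 (1, 1)))).re := by
  simp [PiLp.inner_apply, Fin.sum_univ_three, blochVector, reducedState, partialTraceRight,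
    pureDensity, pauli, Matrix.trace_fin_two, Matrix.mul_apply, zExpectation, Complex.sq_norm,
    Complex.normSq_apply]
  ring

/-- After multiplication by `‖t‖`, the two coefficients here become those of
`inner_blochVector_reducedState` for the `α, β` of `exists_bloch_diagonalization`. -/
theorem zExpectation_firstFactorRotation (α β : ℂ) (h : ‖α‖ ^ 2 + ‖β‖ ^ 2 = 1)
    (ψ : EuclideanSpace ℂ (Fin 2 × Fin 2)) :
    zExpectation (firstFactorRotation 2 α β h ψ) = (‖α‖ ^ 2 - ‖β‖ ^ 2) * zExpectation ψ +
      4 * (α * star β * (ψ (0, 0) * star (ψ (1, 0)) + ψ (0, 1) * star (ψ (1, 1)))).re := by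
  simp [zExpectation, firstFactorRotation, Complex.sq_norm, Complex.normSq_apply]
  ring

/-- Diagonalization of `t · σ` by a special unitary. -/
theorem exists_bloch_diagonalization (t : EuclideanSpace ℝ (Fin 3)) :
    ∃ α β : ℂ, ‖α‖ ^ 2 + ‖β‖ ^ 2 = 1 ∧ ‖t‖ * (‖α‖ ^ 2 - ‖β‖ ^ 2) = t 2 ∧
      2 * ‖t‖ * (α * star β) = (t 0 : ℂ) + t 1 * Complex.I := by
  rcases eq_or_ne t 0 with rfl | ht
  · exact ⟨1, 0, by simp⟩
  have hn : 0 < ‖t‖ := norm_pos_iff.2 ht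
  have hsq : ‖t‖ ^ 2 = t 0 ^ 2 + t 1 ^ 2 + t 2 ^ 2 := by
    simp [EuclideanSpace.norm_sq_eq, Fin.sum_univ_three]
  have habs : |t 2| ≤ ‖t‖ := abs_le_of_sq_le_sq
    (by nlinarith [sq_nonneg (t 0), sq_nonneg (t 1)]) hn.le
  obtain ⟨h1, h2⟩ := abs_le.1 habs
  set w : ℂ := (t 0 : ℂ) + t 1 * Complex.I with hw
  have hwn : ‖w‖ ^ 2 = t 0 ^ 2 + t 1 ^ 2 := by
    rw [Complex.sq_norm, Complex.normSq_apply, hw]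
    simp
    ring
  -- Taking the phase as an exponential of `w.arg` keeps `‖e‖ = 1` even when `w = 0`.
  obtain ⟨e, he, hwe⟩ : ∃ e : ℂ, ‖e‖ = 1 ∧ w = ‖w‖ * e :=
    ⟨Complex.exp (w.arg * Complex.I), Complex.norm_exp_ofReal_mul_I _,
      (Complex.norm_mul_exp_arg_mul_I w).symm⟩
  have ha : 0 ≤ (‖t‖ + t 2) / (2 * ‖t‖) := div_nonneg (by linarith) (by positivity)
  have hb : 0 ≤ (‖t‖ - t 2) / (2 * ‖t‖) := div_nonneg (by linarith) (by positivity)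
  have hab : 2 * ‖t‖ * (√((‖t‖ + t 2) / (2 * ‖t‖)) * √((‖t‖ - t 2) / (2 * ‖t‖))) = ‖w‖ := by
    rw [← sq_eq_sq₀ (by positivity) (norm_nonneg _), mul_pow, mul_pow, mul_pow, Real.sq_sqrt ha,
      Real.sq_sqrt hb, hwn]
    field_simp
    linear_combination hsq
  -- Half-angle formulas: with `cos θ = t 2 / ‖t‖`, the moduli are `cos (θ/2)` and `sin (θ/2)`. The
  -- phase of `β` is conjugated so that `α * star β` points along `w`.
  refine ⟨√((‖t‖ + t 2) / (2 * ‖t‖)), √((‖t‖ - t 2) / (2 * ‖t‖)) * star e, ?_, ?_, ?_⟩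
  · rw [norm_mul, norm_star, he, mul_one, Complex.norm_real, Complex.norm_real, Real.norm_eq_abs,
      Real.norm_eq_abs, sq_abs, sq_abs, Real.sq_sqrt ha, Real.sq_sqrt hb]
    field_simp
    ring
  · rw [norm_mul, norm_star, he, mul_one, Complex.norm_real, Complex.norm_real, Real.norm_eq_abs,
      Real.norm_eq_abs, sq_abs, sq_abs, Real.sq_sqrt ha, Real.sq_sqrt hb]
    field_simp
    ring
  · rw [hwe, ← hab]
    simp
    ring

/-- The law of the Bloch vector of a reduced state is determined by the law of one Pauli
expectation. -/
theorem charFun_map_blochVector (t : EuclideanSpace ℝ (Fin 3)) :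
    charFun ((randomStateEnsemble 2 2).map blochVector) t =
      charFun ((haarPureState 2 2).map fun ψ : PureState 2 2 => zExpectation ψ) ‖t‖ := by
  obtain ⟨α, β, h, hz, hxy⟩ := exists_bloch_diagonalization t
  set V := firstFactorRotation 2 α β h
  have hV : ((haarPureState 2 2).map fun ψ : PureState 2 2 => zExpectation ψ) =
      (haarPureState 2 2).map fun ψ : PureState 2 2 => zExpectation (V ψ) := by
    refine Measure.ext fun s hs => ?_
    rw [← lintegral_indicator_one hs, ← lintegral_indicator_one hs,
      lintegral_map (measurable_one.indicator hs) (by fun_prop),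
      lintegral_map (measurable_one.indicator hs) (by fun_prop)]
    exact (lintegral_haarPureState_comp 2 2 V (F := fun ψ => s.indicator 1 (zExpectation ψ))
      ((measurable_one.indicator hs).comp (by fun_prop))).symm
  rw [hV, randomStateEnsemble, Measure.map_map measurable_blochVector (measurable_reducedState 2 2),
    charFun_apply, charFun_apply_real, integral_map
      (measurable_blochVector.comp (measurable_reducedState 2 2)).aemeasurable (by fun_prop),
    integral_map (by fun_prop) (by fun_prop)]
  refine integral_congr_ae (ae_of_all _ fun ψ => ?_)
  dsimp only
  rw [zExpectation_firstFactorRotation, Function.comp_apply, inner_blochVector_reducedState, ← hz,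
    ← hxy, ← Complex.ofReal_mul]
  congr 3
  rw [show 2 * (‖t‖ : ℂ) = ((2 * ‖t‖ : ℝ) : ℂ) by push_cast; rfl,
    mul_assoc ((2 * ‖t‖ : ℝ) : ℂ), Complex.re_ofReal_mul]
  ring

/-! ### The candidate law on `ℝ³`: marginal and radial law -/

/-- The radial profile of the density of the Bloch vector of the mixture. -/
noncomputable def mixtureProfile (r : ℝ) : ℝ := 3 / Real.pi * (max (1 - r) 0 ^ 2 * (r + 2))

@[fun_prop]
theorem continuous_mixtureProfile : Continuous mixtureProfile := by
  unfold mixtureProfile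
  fun_prop

theorem mixtureProfile_of_le {r : ℝ} (h : r ≤ 1) :
    mixtureProfile r = 3 / Real.pi * (r ^ 3 - 3 * r + 2) := by
  rw [mixtureProfile, max_eq_left (by linarith)]
  ring

theorem mixtureProfile_of_ge {r : ℝ} (h : 1 ≤ r) : mixtureProfile r = 0 := by
  rw [mixtureProfile, max_eq_right (by linarith)]
  simp

theorem mixtureProfile_nonneg {r : ℝ} (h : 0 ≤ r) : 0 ≤ mixtureProfile r := by
  unfold mixtureProfile
  positivity

theorem hasCompactSupport_mixtureProfile_norm {E : Type*} [NormedAddCommGroup E]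
    [ProperSpace E] : HasCompactSupport fun x : E => mixtureProfile ‖x‖ :=
  HasCompactSupport.intro (isCompact_closedBall 0 1) fun x hx =>
    mixtureProfile_of_ge (by simpa using (not_le.1 (mem_closedBall_zero_iff.not.1 hx)).le)

theorem integrable_mixtureProfile_norm {E : Type*} [NormedAddCommGroup E] [NormedSpace ℝ E]
    [FiniteDimensional ℝ E] [MeasurableSpace E] [BorelSpace E]
    (μ : Measure E) [IsFiniteMeasureOnCompacts μ] :
    Integrable (fun x : E => mixtureProfile ‖x‖) μ :=
  haveI := FiniteDimensional.proper_real E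
  Continuous.integrable_of_hasCompactSupport (by fun_prop) hasCompactSupport_mixtureProfile_norm

/-- The law of the Bloch vector of the equiprobable mixture of two random qubit states. -/
noncomputable def mixtureBlochLaw : Measure (EuclideanSpace ℝ (Fin 3)) :=
  volume.withDensity fun x => ENNReal.ofReal (mixtureProfile ‖x‖)

instance isFiniteMeasure_mixtureBlochLaw : IsFiniteMeasure mixtureBlochLaw :=
  isFiniteMeasure_withDensity_ofReal (integrable_mixtureProfile_norm volume).2

/-- The integral of the radial profile over the plane at height `z`. -/
theorem integral_mixtureProfile_slice (z : ℝ) :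
    ∫ y : EuclideanSpace ℝ (Fin 2), mixtureProfile (√(z ^ 2 + ‖y‖ ^ 2)) =
      (Set.Ioc (-1 : ℝ) 1).indicator
        (fun z => 6 * (1 / 5 - z ^ 2 + |z| ^ 3 - |z| ^ 5 / 5)) z := by
  rw [integral_fun_norm_addHaar volume (fun r => mixtureProfile (√(z ^ 2 + r ^ 2)))]
  simp only [finrank_euclideanSpace, Fintype.card_fin, Measure.real,
    EuclideanSpace.volume_ball_fin_two]
  have hge (r : ℝ) (h : 1 ≤ z ^ 2 + r ^ 2) : mixtureProfile (√(z ^ 2 + r ^ 2)) = 0 :=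
    mixtureProfile_of_ge (by rwa [Real.one_le_sqrt])
  by_cases hz : z ^ 2 < 1
  · have hz1 : |z| < 1 := by rwa [← sq_lt_one_iff_abs_lt_one]
    obtain ⟨h1, h2⟩ := abs_lt.1 hz1
    -- The plane at height `z` meets the unit ball in a disc of radius `c`.
    set c := √(1 - z ^ 2) with hc
    have hcsq : c ^ 2 = 1 - z ^ 2 := Real.sq_sqrt (by linarith)
    have hc0 : 0 ≤ c := Real.sqrt_nonneg _
    have hint : ∫ r in Set.Ioi (0 : ℝ), r ^ (2 - 1) • mixtureProfile (√(z ^ 2 + r ^ 2)) =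
        ∫ r in (0 : ℝ)..c, 3 / Real.pi * (r * (√(z ^ 2 + r ^ 2) ^ 3 -
          3 * √(z ^ 2 + r ^ 2) + 2)) := by
      rw [intervalIntegral.integral_of_le hc0,
        setIntegral_eq_of_subset_of_forall_sdiff_eq_zero measurableSet_Ioi
          (Set.Ioc_subset_Ioi_self : Set.Ioc 0 c ⊆ Set.Ioi 0)]
      · refine setIntegral_congr_fun measurableSet_Ioc fun r hr => ?_
        rw [mixtureProfile_of_le, smul_eq_mul]
        · ring
        · refine Real.sqrt_le_iff.2 ⟨zero_le_one, ?_⟩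
          nlinarith [hr.1, hr.2]
      · intro r hr
        have hr0 : 0 < r := hr.1
        have hrc : c < r := by
          by_contra! h
          exact hr.2 ⟨hr0, h⟩
        rw [hge r (by nlinarith), smul_zero]
    have hftc : ∫ r in (0 : ℝ)..c, 3 / Real.pi * (r * (√(z ^ 2 + r ^ 2) ^ 3 -
          3 * √(z ^ 2 + r ^ 2) + 2)) = 3 / Real.pi * (√(z ^ 2 + c ^ 2) ^ 5 / 5 -
          √(z ^ 2 + c ^ 2) ^ 3 + (z ^ 2 + c ^ 2)) - 3 / Real.pi *
          (√(z ^ 2 + 0 ^ 2) ^ 5 / 5 - √(z ^ 2 + 0 ^ 2) ^ 3 + (z ^ 2 + 0 ^ 2)) := by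
      -- With `s = √(z² + r²)` one has `r dr = s ds`, so the primitive is that of `s⁴ - 3s² + 2s`.
      -- Derivatives are needed only in the open interval, which avoids `r = 0`, where `s` is not
      -- differentiable if `z = 0`.
      refine intervalIntegral.integral_eq_sub_of_hasDerivAt_of_le hc0
        (f := fun r => 3 / Real.pi * (√(z ^ 2 + r ^ 2) ^ 5 / 5 -
          √(z ^ 2 + r ^ 2) ^ 3 + (z ^ 2 + r ^ 2))) (by fun_prop) (fun r hr => ?_)
        (Continuous.intervalIntegrable (by fun_prop) _ _)
      have hr0 : 0 < r := hr.1
      have hpos : 0 < z ^ 2 + r ^ 2 := by positivity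
      have hs := ((hasDerivAt_pow 2 r).const_add (z ^ 2)).sqrt hpos.ne'
      have hs0 : 0 < √(z ^ 2 + r ^ 2) := Real.sqrt_pos.2 hpos
      refine (((((hs.fun_pow 5).div_const 5).fun_sub (hs.fun_pow 3)).fun_add
        ((hasDerivAt_pow 2 r).const_add (z ^ 2))).const_mul (3 / Real.pi)).congr_deriv ?_
      field_simp
      norm_num
      ring
    rw [Set.indicator_of_mem (show z ∈ Set.Ioc (-1 : ℝ) 1 from ⟨h1, h2.le⟩), hint, hftc, hcsq]
    simp only [add_sub_cancel, Real.sqrt_one, ne_eq, OfNat.ofNat_ne_zero, not_false_eq_true,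
      zero_pow, add_zero, Real.sqrt_sq_eq_abs, ENNReal.ofReal_one, one_pow, one_mul,
      ENNReal.toReal_ofReal Real.pi_pos.le, smul_eq_mul, nsmul_eq_mul]
    have h5 : |z| ^ 5 = |z| ^ 3 * z ^ 2 := by
      rw [← sq_abs z]
      ring
    rw [h5]
    field_simp
    norm_num
    ring
  · have h0 : ∀ r : ℝ, mixtureProfile (√(z ^ 2 + r ^ 2)) = 0 := fun r =>
      hge r (by nlinarith [sq_nonneg r])
    simp only [h0, smul_zero, integral_zero]
    symm
    rw [Set.indicator_apply_eq_zero]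
    rintro ⟨h1, h2⟩
    -- The half-open interval leaves only the endpoint `1`, where the polynomial vanishes.
    have h3 : z = 1 := by nlinarith
    subst h3
    norm_num

/-- Splitting off the first coordinate in `ℝ³`. -/
noncomputable def splitFirstCoordinate : EuclideanSpace ℝ (Fin 3) ≃ₗᵢ[ℝ]
    WithLp 2 (ℝ × EuclideanSpace ℝ (Fin 2)) where
  toFun x := WithLp.toLp 2 (x 0, WithLp.toLp 2 fun i => x i.succ)
  invFun p := WithLp.toLp 2 (Fin.cons p.fst fun i => p.snd i)
  map_add' _ _ := rfl
  map_smul' _ _ := rfl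
  left_inv x := by
    ext i
    fin_cases i <;> rfl
  right_inv _ := rfl
  norm_map' x := by
    rw [← sq_eq_sq₀ (norm_nonneg _) (norm_nonneg _), WithLp.prod_norm_sq_eq_of_L2]
    change ‖x 0‖ ^ 2 + ‖WithLp.toLp 2 fun i : Fin 2 => x i.succ‖ ^ 2 = ‖x‖ ^ 2
    simp [EuclideanSpace.norm_sq_eq, Fin.sum_univ_three]
    ring

/-- The law is rotation invariant, so `t` may be moved onto the first axis. Fubini then leaves the
Fourier transform of the marginal along that axis. -/
theorem charFun_mixtureBlochLaw (t : EuclideanSpace ℝ (Fin 3)) :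
    charFun mixtureBlochLaw t =
      ∫ z in (-1 : ℝ)..1, (6 * (1 / 5 - z ^ 2 + |z| ^ 3 - |z| ^ 5 / 5) : ℝ) *
        Complex.exp (‖t‖ * Complex.I * z) := by
  -- Since `v` and `t` have equal norms, the reflection in the hyperplane orthogonal to `v - t`
  -- exchanges them.
  set v : EuclideanSpace ℝ (Fin 3) := EuclideanSpace.single 0 ‖t‖ with hv
  set R := Submodule.reflection (Submodule.span ℝ {v - t})ᗮ
  have hR : R v = t := Submodule.reflection_sub (by simp [hv])
  have hinner (x : EuclideanSpace ℝ (Fin 3)) : inner ℝ (R x) t = ‖t‖ * x 0 := by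
    rw [← hR, LinearIsometryEquiv.inner_map_map, hR, hv, EuclideanSpace.inner_single_right]
    simp
  let g : ℝ × EuclideanSpace ℝ (Fin 2) → ℂ := fun p =>
    Complex.exp (‖t‖ * Complex.I * p.1) * mixtureProfile (√(p.1 ^ 2 + ‖p.2‖ ^ 2))
  have hg (x : EuclideanSpace ℝ (Fin 3)) : g (WithLp.ofLp (splitFirstCoordinate x)) =
      Complex.exp (‖t‖ * Complex.I * x 0) * mixtureProfile ‖x‖ := by
    have hx : ‖x‖ = √((splitFirstCoordinate x).fst ^ 2 + ‖(splitFirstCoordinate x).snd‖ ^ 2) := by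
      rw [← sq_abs, ← Real.norm_eq_abs, ← WithLp.prod_norm_sq_eq_of_L2,
        LinearIsometryEquiv.norm_map, Real.sqrt_sq (norm_nonneg _)]
    rw [hx]
    rfl
  have hmp : MeasurePreserving (fun x => WithLp.ofLp (splitFirstCoordinate x)) :=
    (WithLp.volume_preserving_ofLp ℝ (EuclideanSpace ℝ (Fin 2))).comp
      splitFirstCoordinate.measurePreserving
  have hemb : MeasurableEmbedding fun x => WithLp.ofLp (splitFirstCoordinate x) :=
    (MeasurableEquiv.toLp 2 (ℝ × EuclideanSpace ℝ (Fin 2))).symm.measurableEmbedding.comp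
      splitFirstCoordinate.toHomeomorph.measurableEmbedding
  have hgi : Integrable g := by
    rw [← hmp.integrable_comp_emb hemb]
    refine ((integrable_mixtureProfile_norm
      (volume : Measure (EuclideanSpace ℝ (Fin 3)))).ofReal (𝕜 := ℂ)).mono (by
        refine Continuous.aestronglyMeasurable ?_
        rw [show g ∘ _ = _ from funext hg]
        fun_prop) (ae_of_all _ fun x => ?_)
    rw [Function.comp_apply, hg, norm_mul]
    refine le_of_eq ?_
    rw [show (‖t‖ : ℂ) * Complex.I * (x 0 : ℂ) = ((‖t‖ * x 0 : ℝ) : ℂ) * Complex.I by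
      push_cast; ring, Complex.norm_exp_ofReal_mul_I, one_mul]
    rfl
  calc
    _ = ∫ x : EuclideanSpace ℝ (Fin 3), mixtureProfile ‖x‖ *
          Complex.exp (inner ℝ x t * Complex.I) := by
      rw [charFun_apply, mixtureBlochLaw,
        integral_withDensity_eq_integral_toReal_smul (by fun_prop) (by simp)]
      refine integral_congr_ae (ae_of_all _ fun x => ?_)
      dsimp only
      rw [ENNReal.toReal_ofReal (mixtureProfile_nonneg (norm_nonneg _)), Complex.real_smul]
    _ = ∫ x : EuclideanSpace ℝ (Fin 3), g (WithLp.ofLp (splitFirstCoordinate x)) := by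
      rw [← R.measurePreserving.integral_comp R.toHomeomorph.measurableEmbedding]
      refine integral_congr_ae (ae_of_all _ fun x => ?_)
      dsimp only
      rw [hg, hinner, LinearIsometryEquiv.norm_map]
      push_cast
      ring_nf
    _ = ∫ p, g p := hmp.integral_comp hemb g
    _ = ∫ z : ℝ, Complex.exp (‖t‖ * Complex.I * z) *
        ((Set.Ioc (-1 : ℝ) 1).indicator
          (fun z => 6 * (1 / 5 - z ^ 2 + |z| ^ 3 - |z| ^ 5 / 5)) z : ℝ) := by
      rw [Measure.volume_eq_prod, integral_prod _ hgi]
      refine integral_congr_ae (ae_of_all _ fun z => ?_)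
      simp only [g]
      rw [integral_const_mul, integral_complex_ofReal, integral_mixtureProfile_slice]
    _ = _ := by
      rw [intervalIntegral.integral_of_le (by norm_num), ← integral_indicator measurableSet_Ioc]
      refine integral_congr_ae (ae_of_all _ fun z => ?_)
      by_cases hz : z ∈ Set.Ioc (-1 : ℝ) 1
      · simp only [Set.indicator_of_mem hz]
        ring
      · simp only [Set.indicator_of_notMem hz, Complex.ofReal_zero, mul_zero]

theorem map_norm_mixtureBlochLaw :
    mixtureBlochLaw.map (fun x => ‖x‖) = (volume : Measure ℝ).withDensity fun r =>
      ENNReal.ofReal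
        ((Set.Icc (0 : ℝ) 1).indicator (fun r => 12 * r ^ 2 * (r ^ 3 - 3 * r + 2)) r) := by
  refine Measure.ext fun s hs => ?_
  have h := lintegral_angular_mul_radial (volume : Measure (EuclideanSpace ℝ (Fin 3)))
    (F := fun _ => 1) measurable_const
    (g := fun r => ENNReal.ofReal (mixtureProfile r) * s.indicator 1 r)
    (by exact Measurable.mul (by fun_prop) (measurable_one.indicator hs))
  simp only [one_mul, lintegral_one, Measure.toSphere_apply_univ, finrank_euclideanSpace,
    Fintype.card_fin, EuclideanSpace.volume_ball_fin_three] at h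
  rw [← lintegral_indicator_one hs, ← lintegral_indicator_one hs,
    lintegral_map (measurable_one.indicator hs) (by fun_prop), mixtureBlochLaw,
    lintegral_withDensity_eq_lintegral_mul _ (by fun_prop)
      (g := fun x => s.indicator 1 ‖x‖) ((measurable_one.indicator hs).comp measurable_norm),
    lintegral_withDensity_eq_lintegral_mul _ (by
      refine ENNReal.measurable_ofReal.comp (Measurable.indicator (by fun_prop) measurableSet_Icc))
      (measurable_one.indicator hs)]
  refine h.trans ?_
  rw [← lintegral_const_mul _ (by
    exact Measurable.mul (by fun_prop) (Measurable.mul (by fun_prop) (measurable_one.indicator hs))),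
    ← lintegral_indicator measurableSet_Ioi]
  refine lintegral_congr fun r => ?_
  by_cases hr : 0 < r
  · rw [Set.indicator_of_mem (show r ∈ Set.Ioi 0 from hr), Pi.mul_apply, ← mul_assoc, ← mul_assoc]
    congr 1
    -- The unit sphere has area `3 · (4/3)π = 4π`, which against the factor `3/π` of the profile
    -- gives 12.
    have h3 : ((3 : ℕ) : ENNReal) = ENNReal.ofReal 3 := by norm_num
    rw [h3, ENNReal.ofReal_one, one_pow, one_mul, ← ENNReal.ofReal_mul (by positivity),
      ← ENNReal.ofReal_mul (by positivity), ← ENNReal.ofReal_mul (by positivity)]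
    congr 1
    by_cases hr1 : r ≤ 1
    · rw [Set.indicator_of_mem (show r ∈ Set.Icc (0 : ℝ) 1 from ⟨hr.le, hr1⟩), mixtureProfile_of_le hr1]
      field_simp
      ring
    · rw [Set.indicator_of_notMem (fun h => hr1 h.2), mixtureProfile_of_ge (not_le.1 hr1).le,
        mul_zero]
  · rw [Set.indicator_of_notMem (show r ∉ Set.Ioi 0 from hr), Pi.mul_apply]
    rcases eq_or_lt_of_le (not_lt.1 hr) with rfl | hlt
    · simp
    · rw [Set.indicator_of_notMem (fun h => hlt.not_ge h.1)]
      simp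

/-! ### The Fourier identity -/

/-- Repeated integration by parts: a primitive of `p(z) exp(cz)` is `exp(cz)` times the alternating
sum of `p⁽ᵏ⁾(z) / c^(k+1)`. Only the powers occurring in the two densities are kept. -/
theorem integral_quintic_mul_cexp (a₀ a₂ a₃ a₅ : ℂ) {c : ℂ} (hc : c ≠ 0) (a b : ℝ) :
    ∫ z in a..b, (a₀ + a₂ * z ^ 2 + a₃ * z ^ 3 + a₅ * z ^ 5) * Complex.exp (c * z) =
      ((a₀ + a₂ * b ^ 2 + a₃ * b ^ 3 + a₅ * b ^ 5) / c
        - (2 * a₂ * b + 3 * a₃ * b ^ 2 + 5 * a₅ * b ^ 4) / c ^ 2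
        + (2 * a₂ + 6 * a₃ * b + 20 * a₅ * b ^ 3) / c ^ 3
        - (6 * a₃ + 60 * a₅ * b ^ 2) / c ^ 4 + 120 * a₅ * b / c ^ 5 - 120 * a₅ / c ^ 6) *
          Complex.exp (c * b) -
      ((a₀ + a₂ * a ^ 2 + a₃ * a ^ 3 + a₅ * a ^ 5) / c
        - (2 * a₂ * a + 3 * a₃ * a ^ 2 + 5 * a₅ * a ^ 4) / c ^ 2
        + (2 * a₂ + 6 * a₃ * a + 20 * a₅ * a ^ 3) / c ^ 3
        - (6 * a₃ + 60 * a₅ * a ^ 2) / c ^ 4 + 120 * a₅ * a / c ^ 5 - 120 * a₅ / c ^ 6) *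
          Complex.exp (c * a) := by
  refine intervalIntegral.integral_eq_sub_of_hasDerivAt (f := fun z : ℝ =>
      ((a₀ + a₂ * z ^ 2 + a₃ * z ^ 3 + a₅ * z ^ 5) / c
        - (2 * a₂ * z + 3 * a₃ * z ^ 2 + 5 * a₅ * z ^ 4) / c ^ 2
        + (2 * a₂ + 6 * a₃ * z + 20 * a₅ * z ^ 3) / c ^ 3
        - (6 * a₃ + 60 * a₅ * z ^ 2) / c ^ 4 + 120 * a₅ * z / c ^ 5 - 120 * a₅ / c ^ 6) *
          Complex.exp (c * z)) (fun z _ => ?_)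
    (Continuous.intervalIntegrable (by fun_prop) _ _)
  have p (n : ℕ) (k : ℂ) := (hasDerivAt_pow n (z : ℂ)).const_mul k
  have e : HasDerivAt (fun w : ℂ => Complex.exp (c * w)) (Complex.exp (c * z) * (c * 1)) z :=
    ((hasDerivAt_id (z : ℂ)).const_mul c).cexp
  have h := ((((((((((p 2 a₂).const_add a₀).add (p 3 a₃)).add (p 5 a₅)).div_const c).sub
    ((((p 1 (2 * a₂)).add (p 2 (3 * a₃))).add (p 4 (5 * a₅))).div_const (c ^ 2))).add
    ((((p 1 (6 * a₃)).const_add (2 * a₂)).add (p 3 (20 * a₅))).div_const (c ^ 3))).sub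
    (((p 2 (60 * a₅)).const_add (6 * a₃)).div_const (c ^ 4))).add
    ((p 1 (120 * a₅)).div_const (c ^ 5))).sub_const (120 * a₅ / c ^ 6)).mul e
  have h' := h.comp_ofReal
  refine (h'.congr_deriv ?_).congr_of_eventuallyEq (Filter.Eventually.of_forall fun y => ?_)
  · simp only [Pi.add_apply, Pi.sub_apply]
    field_simp
    norm_num
    ring
  · simp only [Pi.add_apply, Pi.sub_apply, Pi.mul_apply, pow_one]

/-- The characteristic function of the law of a Pauli expectation. -/
theorem charFun_map_zExpectation (u : ℝ) :
    charFun ((haarPureState 2 2).map fun ψ : PureState 2 2 => zExpectation ψ) u =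
      ∫ z in (-1 : ℝ)..1, (3 / 4 + (-3 / 4) * (z : ℂ) ^ 2) * Complex.exp (u * Complex.I * z) := by
  rw [map_zExpectation, charFun_apply_real,
    integral_withDensity_eq_integral_toReal_smul (by fun_prop) (by simp),
    intervalIntegral.integral_of_le (by norm_num), integral_Ioc_eq_integral_Ioo]
  refine setIntegral_congr_fun measurableSet_Ioo fun z hz => ?_
  rw [ENNReal.toReal_ofReal (by nlinarith [hz.1, hz.2]), Complex.real_smul]
  push_cast
  congr 1
  · ring
  · congr 1
    ring

/-- The square of the Fourier transform of `3/4 (1 - z²)` at half the argument is the Fourier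
transform of `6 (1/5 - z² + |z|³ - |z|⁵/5)`. -/
theorem sq_integral_cexp_eq (u : ℝ) :
    (∫ z in (-1 : ℝ)..1, (3 / 4 + (-3 / 4) * (z : ℂ) ^ 2) *
      Complex.exp ((1 / 2 * u : ℝ) * Complex.I * z)) ^ 2 =
    ∫ z in (-1 : ℝ)..1, (6 * (1 / 5 - z ^ 2 + |z| ^ 3 - |z| ^ 5 / 5) : ℝ) *
      Complex.exp (u * Complex.I * z) := by
  have hc : Continuous fun z : ℝ => ((6 * (1 / 5 - z ^ 2 + |z| ^ 3 - |z| ^ 5 / 5) : ℝ) : ℂ) *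
      Complex.exp (u * Complex.I * z) := by fun_prop
  rw [← intervalIntegral.integral_add_adjacent_intervals (hc.intervalIntegrable (-1) 0)
    (hc.intervalIntegrable 0 1)]
  have h1 : ∫ z in (-1 : ℝ)..0, ((6 * (1 / 5 - z ^ 2 + |z| ^ 3 - |z| ^ 5 / 5) : ℝ) : ℂ) *
      Complex.exp (u * Complex.I * z) = ∫ z in (-1 : ℝ)..0,
      (6 / 5 + (-6) * (z : ℂ) ^ 2 + (-6) * (z : ℂ) ^ 3 + 6 / 5 * (z : ℂ) ^ 5) *
        Complex.exp (u * Complex.I * z) := by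
    refine intervalIntegral.integral_congr fun z hz => ?_
    rw [Set.uIcc_of_le (by norm_num)] at hz
    rw [abs_of_nonpos hz.2]
    push_cast
    ring
  have h2 : ∫ z in (0 : ℝ)..1, ((6 * (1 / 5 - z ^ 2 + |z| ^ 3 - |z| ^ 5 / 5) : ℝ) : ℂ) *
      Complex.exp (u * Complex.I * z) = ∫ z in (0 : ℝ)..1,
      (6 / 5 + (-6) * (z : ℂ) ^ 2 + 6 * (z : ℂ) ^ 3 + (-6 / 5) * (z : ℂ) ^ 5) *
        Complex.exp (u * Complex.I * z) := by
    refine intervalIntegral.integral_congr fun z hz => ?_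
    rw [Set.uIcc_of_le (by norm_num)] at hz
    rw [abs_of_nonneg hz.1]
    push_cast
    ring
  rw [h1, h2]
  -- The closed forms divide by `c = iu`, so `u = 0` is checked separately; there both sides are
  -- total masses equal to 1.
  rcases eq_or_ne u 0 with rfl | hu
  · have e1 : ∫ z in (-1 : ℝ)..1, ((3 / 4 : ℂ) + (-3 / 4) * (z : ℂ) ^ 2) = 1 := by
      have : ∫ z in (-1 : ℝ)..1, (3 / 4 + (-3 / 4) * z ^ 2 : ℝ) = 1 := by
        rw [intervalIntegral.integral_add] <;> first
          | exact Continuous.intervalIntegrable (by fun_prop) _ _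
          | norm_num [integral_pow]
      have h := congrArg (fun x : ℝ => (x : ℂ)) this
      simp only [← intervalIntegral.integral_ofReal] at h
      simpa using h
    have e2 : ∫ z in (-1 : ℝ)..0, ((6 / 5 : ℂ) + (-6) * (z : ℂ) ^ 2 + (-6) * (z : ℂ) ^ 3 +
        6 / 5 * (z : ℂ) ^ 5) = 1 / 2 := by
      have : ∫ z in (-1 : ℝ)..0, (6 / 5 + (-6) * z ^ 2 + (-6) * z ^ 3 + 6 / 5 * z ^ 5 : ℝ)
          = 1 / 2 := by
        rw [intervalIntegral.integral_add, intervalIntegral.integral_add,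
          intervalIntegral.integral_add] <;> first
          | exact Continuous.intervalIntegrable (by fun_prop) _ _
          | norm_num [integral_pow]
      have h := congrArg (fun x : ℝ => (x : ℂ)) this
      simp only [← intervalIntegral.integral_ofReal] at h
      simpa using h
    have e3 : ∫ z in (0 : ℝ)..1, ((6 / 5 : ℂ) + (-6) * (z : ℂ) ^ 2 + 6 * (z : ℂ) ^ 3 +
        (-6 / 5) * (z : ℂ) ^ 5) = 1 / 2 := by
      have : ∫ z in (0 : ℝ)..1, (6 / 5 + (-6) * z ^ 2 + 6 * z ^ 3 + (-6 / 5) * z ^ 5 : ℝ)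
          = 1 / 2 := by
        rw [intervalIntegral.integral_add, intervalIntegral.integral_add,
          intervalIntegral.integral_add] <;> first
          | exact Continuous.intervalIntegrable (by fun_prop) _ _
          | norm_num [integral_pow]
      have h := congrArg (fun x : ℝ => (x : ℂ)) this
      simp only [← intervalIntegral.integral_ofReal] at h
      simpa using h
    simp only [mul_zero, Complex.ofReal_zero, zero_mul, Complex.exp_zero, mul_one, e1, e2, e3]
    norm_num
  · have hc0 : (u : ℂ) * Complex.I ≠ 0 := by simp [hu]
    have hh : ((1 / 2 * u : ℝ) : ℂ) * Complex.I = (u : ℂ) * Complex.I / 2 := by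
      push_cast
      ring
    rw [hh]
    generalize (u : ℂ) * Complex.I = c at hc0
    have hA := integral_quintic_mul_cexp (3 / 4) (-3 / 4) 0 0 (div_ne_zero hc0 two_ne_zero) (-1) 1
    simp only [zero_mul, add_zero] at hA
    rw [hA, integral_quintic_mul_cexp _ _ _ _ hc0, integral_quintic_mul_cexp _ _ _ _ hc0]
    have e1 : Complex.exp (c * (1 : ℝ)) = Complex.exp (c / 2 * (1 : ℝ)) ^ 2 := by
      rw [← Complex.exp_nat_mul]
      congr 1
      push_cast
      ring
    have e2 : Complex.exp (c * (-1 : ℝ)) = Complex.exp (c / 2 * (-1 : ℝ)) ^ 2 := by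
      rw [← Complex.exp_nat_mul]
      congr 1
      push_cast
      ring
    have e3 : Complex.exp (c / 2 * (1 : ℝ)) * Complex.exp (c / 2 * (-1 : ℝ)) = 1 := by
      rw [← Complex.exp_add]
      simp
    have e4 : Complex.exp (c * (0 : ℝ)) = 1 := by simp
    rw [e1, e2, e4]
    -- Every exponential is a power of `X = exp(c/2)` or of its inverse, so what remains is a
    -- rational identity in `c` and `X`.
    generalize Complex.exp (c / 2 * (1 : ℝ)) = X at e3 ⊢
    generalize Complex.exp (c / 2 * (-1 : ℝ)) = Y at e3 ⊢
    have hX : X ≠ 0 := left_ne_zero_of_mul_eq_one e3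
    have hY : Y = X⁻¹ := eq_inv_of_mul_eq_one_right e3
    subst hY
    push_cast
    field_simp
    ring

/-! ### The mixture of two independent states -/

theorem blochVector_half_add (ρ₁ ρ₂ : Matrix (Fin 2) (Fin 2) ℂ) :
    blochVector ((1 / 2 : ℂ) • (ρ₁ + ρ₂)) =
      (1 / 2 : ℝ) • (blochVector ρ₁ + blochVector ρ₂) := by
  ext j
  have h : (1 / 2 : ℂ) = ((1 / 2 : ℝ) : ℂ) := by push_cast; rfl
  simp only [blochVector, PiLp.smul_apply, PiLp.add_apply, smul_eq_mul, Matrix.smul_mul,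
    Matrix.trace_smul, add_mul, Matrix.trace_add]
  rw [h, Complex.re_ofReal_mul, Complex.add_re]

theorem ae_randomStateEnsemble (d k : ℕ) :
    ∀ᵐ ρ ∂randomStateEnsemble d k, ρ.IsHermitian ∧ ρ.trace = 1 := by
  have h (i j : Fin d) : Measurable fun ρ : Matrix (Fin d) (Fin d) ℂ => ρ i j :=
    (measurable_pi_apply j).comp (measurable_pi_apply i)
  have hm : MeasurableSet {ρ : Matrix (Fin d) (Fin d) ℂ | ρ.IsHermitian ∧ ρ.trace = 1} := by
    refine MeasurableSet.inter ?_ ?_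
    · have : {ρ : Matrix (Fin d) (Fin d) ℂ | ρ.IsHermitian} =
          ⋂ i, ⋂ j, {ρ | star (ρ j i) = ρ i j} := by
        ext ρ
        simp [Matrix.IsHermitian.ext_iff]
      change MeasurableSet {ρ : Matrix (Fin d) (Fin d) ℂ | ρ.IsHermitian}
      rw [this]
      exact .iInter fun i => .iInter fun j =>
        measurableSet_eq_fun (continuous_star.measurable.comp (h j i)) (h i j)
    · refine measurableSet_eq_fun ?_ measurable_const
      exact Finset.measurable_sum _ fun i _ => h i i
  rw [randomStateEnsemble, ae_map_iff (measurable_reducedState d k).aemeasurable hm]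
  exact ae_of_all _ fun ψ => ⟨(reducedState_posSemidef d k ψ).isHermitian,
    reducedState_trace d k ψ⟩

theorem map_blochVector_mixture {Ω : Type*} [MeasurableSpace Ω] (P : Measure Ω)
    [IsProbabilityMeasure P] (ρ₁ ρ₂ : Ω → Matrix (Fin 2) (Fin 2) ℂ)
    (h₁ : HasLaw ρ₁ (randomStateEnsemble 2 2) P) (h₂ : HasLaw ρ₂ (randomStateEnsemble 2 2) P)
    (hindep : IndepFun ρ₁ ρ₂ P) :
    HasLaw (fun ω => blochVector ((1 / 2 : ℂ) • (ρ₁ ω + ρ₂ ω))) mixtureBlochLaw P := by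
  have hm := measurable_blochVector
  have hm₁ : AEMeasurable (fun ω => blochVector (ρ₁ ω)) P := hm.comp_aemeasurable h₁.aemeasurable
  have hm₂ : AEMeasurable (fun ω => blochVector (ρ₂ ω)) P := hm.comp_aemeasurable h₂.aemeasurable
  have hlaw {ρ : Ω → Matrix (Fin 2) (Fin 2) ℂ} (h : HasLaw ρ (randomStateEnsemble 2 2) P) :
      P.map (fun ω => blochVector (ρ ω)) = (randomStateEnsemble 2 2).map blochVector := by
    rw [← h.map_eq, AEMeasurable.map_map_of_aemeasurable hm.aemeasurable h.aemeasurable]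
    rfl
  simp only [blochVector_half_add]
  refine ⟨(hm₁.add hm₂).const_smul (1 / 2 : ℝ), ?_⟩
  -- The factor `1/2` of the mixture moves onto the argument `t`, and independence makes the
  -- characteristic function a product of two equal factors.
  refine Measure.ext_of_charFun (funext fun t => ?_)
  rw [charFun_map_smul_comp (f := fun ω => blochVector (ρ₁ ω) + blochVector (ρ₂ ω))
    (hm₁.add hm₂), (hindep.comp hm hm).charFun_map_fun_add_eq_mul hm₁ hm₂, Pi.mul_apply]
  change charFun (P.map fun ω => blochVector (ρ₁ ω)) _ *
    charFun (P.map fun ω => blochVector (ρ₂ ω)) _ = _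
  rw [hlaw h₁, hlaw h₂, charFun_map_blochVector, charFun_map_zExpectation,
    charFun_mixtureBlochLaw, ← sq, norm_smul, Real.norm_of_nonneg (by norm_num),
    sq_integral_cexp_eq]

theorem mainTheorem3 {Ω : Type*} [MeasurableSpace Ω] (P : Measure Ω) [IsProbabilityMeasure P]
    (ρ₁ ρ₂ : Ω → Matrix (Fin 2) (Fin 2) ℂ)
    (h₁ : HasLaw ρ₁ (randomStateEnsemble 2 2) P)
    (h₂ : HasLaw ρ₂ (randomStateEnsemble 2 2) P)
    (hindep : IndepFun ρ₁ ρ₂ P) :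
    (∀ᵐ ω ∂P, (1 / 2 : ℂ) • (ρ₁ ω + ρ₂ ω) =
      blochState (blochVector ((1 / 2 : ℂ) • (ρ₁ ω + ρ₂ ω)))) ∧
    HasLaw (fun ω => ‖blochVector ((1 / 2 : ℂ) • (ρ₁ ω + ρ₂ ω))‖)
      ((volume : Measure ℝ).withDensity fun r =>
        ENNReal.ofReal
          ((Set.Icc (0 : ℝ) 1).indicator (fun r => 12 * r ^ 2 * (r ^ 3 - 3 * r + 2)) r)) P := by
  refine ⟨?_, ?_⟩
  · have hae {ρ : Ω → Matrix (Fin 2) (Fin 2) ℂ} (h : HasLaw ρ (randomStateEnsemble 2 2) P) :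
        ∀ᵐ ω ∂P, (ρ ω).IsHermitian ∧ (ρ ω).trace = 1 :=
      ae_of_ae_map h.aemeasurable (h.map_eq ▸ ae_randomStateEnsemble 2 2)
    filter_upwards [hae h₁, hae h₂] with ω hω₁ hω₂
    refine (blochState_eq_iff ?_ ?_ _).2 rfl
    · rw [Matrix.IsHermitian, Matrix.conjTranspose_smul, Matrix.conjTranspose_add, hω₁.1.eq,
        hω₂.1.eq]
      simp
    · rw [Matrix.trace_smul, Matrix.trace_add, hω₁.2, hω₂.2]
      norm_num
  · have hnorm : HasLaw (fun x : EuclideanSpace ℝ (Fin 3) => ‖x‖) _ mixtureBlochLaw :=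
      ⟨measurable_norm.aemeasurable, map_norm_mixtureBlochLaw⟩
    exact hnorm.fun_comp (map_blochVector_mixture P ρ₁ ρ₂ h₁ h₂ hindep)
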